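/- Let $d$ be a prime and $n\ge 0$. For $(p,q)\in\mathbb Z_d^2$, represented by integers $P,Q\in\{0,\dots,d-1\}$, let $w(p,q)$ be the Weyl operator on $L^2(\mathbb Z_d)\cong\mathbb C^d$ given by $$(w(p,q)\psi)(x)=\tau_{2d}(-PQ)\,\chi_d(Px)\,\psi(x-Q),\qquad \chi_m(y)=e^{2\pi i y/m},\quad \tau_{2d}(y)=\chi_{2d}((d^2+1)y),$$ and for $v=(v_1,\dots,v_n)$ with $v_i\in\mathbb Z_d^2$, i.e. for $v$ in the phase space $\mathbb Z_d^{2n}$ (a vector space, since $d$ is prime), let $w(v)=\bigotimes_{i=1}^n w(v_i)$ on $(\mathbb C^d)^{\otimes n}$. A stabilizer group is a group $G$ of complex multiples of Weyl operators $w(v)$ such that the only multiple of $\mathbb 1$ in $G$ is $\mathbb 1$ itself (such a $G$ is finite), and its stabilizer state is $\rho_G=d^{-n}\sum_{g\in G}g$, which may be pure or mixed. The entropy vector of $\rho$ is $(S(\rho_I))_{I\subseteq[n]}$, where $[n]=\{1,\dots,n\}$, $\rho_I=\mathrm{tr}_{I^c}\rho$ is the reduced state and $S(\sigma)=-\mathrm{tr}(\sigma\log\sigma)$.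 Call a vector $f=(f_I)_{I\subseteq[n]}$ of real coefficients a linear rank inequality if $$\sum_{I\subseteq[n]}f_I\,\dim\operatorname{span}\Big(\bigcup_{i\in I}U_i\Big)\ \ge\ 0$$ for every finite field $\mathbb F$, every finite-dimensional $\mathbb F$-vector space $V$ and all subspaces $U_1,\dots,U_n\subseteq V$; call $f$ balanced if $\sum_{I\ni i}f_I=0$ for every $i\in[n]$. \textbf{Theorem.} The entropy vectors of stabilizer states with prime local dimension $d$ satisfy every balanced linear rank inequality: if $\rho$ is a stabilizer state of $n$ systems of prime local dimension $d$, and $f$ is a balanced linear rank inequality, then $$\sum_{I\subseteq[n]}f_I\,S(\rho_I)\ \ge\ 0 .$$ -/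

import Mathlib

namespace Stab

/-! Operators on `L²(ℤ_d^n) ≅ (ℂ^d)^{⊗ n}` are matrices indexed by the configuration space
`Fin n → ZMod d`; the tensor factors are the coordinates. -/

/-- The operators on the Hilbert space of `n` systems of local dimension `d`. -/
abbrev Op (d n : ℕ) : Type := Matrix (Fin n → ZMod d) (Fin n → ZMod d) ℂ

/-- The phase space `ℤ_d^{2n}`: the `i`-th entry of `v` is the pair `(v_{p_i}, v_{q_i})`. -/
abbrev PhaseSpace (d n : ℕ) : Type := Fin n → ZMod d × ZMod d

/-- `χ_d(x) = exp(2πi x / d)` for an integer `x`. -/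
noncomputable def chi (d : ℕ) (x : ℤ) : ℂ :=
  Complex.exp (2 * Real.pi * Complex.I * (x : ℂ) / (d : ℂ))

/-- `τ_{2d}(y) = χ_{2d}((d² + 1) y)`. -/
noncomputable def tau (d : ℕ) (y : ℤ) : ℂ := chi (2 * d) (((d : ℤ) ^ 2 + 1) * y)

/-- The matrix of the operator `(W(P,Q) ψ)(x) = τ_{2d}(-PQ) χ_d(P x) ψ(x - Q)` on functions
`ψ : ℤ_d → ℂ`, for integers `P`, `Q`. -/
noncomputable def weylInt (d : ℕ) (P Q : ℤ) : Matrix (ZMod d) (ZMod d) ℂ :=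
  Matrix.of fun x y =>
    if y = x - (Q : ZMod d) then tau d (-(P * Q)) * chi d (P * (x.val : ℤ)) else 0

/-- The one-system Weyl operator `w(p,q)`, with the representatives of `p`, `q` taken
in `{0, …, d-1}`. -/
noncomputable def weylOne (d : ℕ) (u : ZMod d × ZMod d) : Matrix (ZMod d) (ZMod d) ℂ :=
  weylInt d (u.1.val : ℤ) (u.2.val : ℤ)

/-- The Weyl operator `w(v) = w(v_1) ⊗ ⋯ ⊗ w(v_n)`. -/
noncomputable def weyl {d n : ℕ} (v : PhaseSpace d n) : Op d n :=
  Matrix.of fun x y => ∏ i, weylOne d (v i) (x i) (y i)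

/-- A stabilizer group: a group of multiples of Weyl operators in which the only multiple of
the identity is the identity itself. -/
structure IsStabilizerGroup {d n : ℕ} [NeZero d] (G : Subgroup (Op d n)ˣ) : Prop where
  multiple_weyl : ∀ g ∈ G, ∃ (c : ℂ) (v : PhaseSpace d n), (g : Op d n) = c • weyl v
  eq_one : ∀ g ∈ G, ∀ c : ℂ, (g : Op d n) = c • (1 : Op d n) → g = 1

/-- Stabilizer groups are finite, so that the sum defining a stabilizer state makes sense. -/
theorem IsStabilizerGroup.finite {d n : ℕ} [NeZero d] {G : Subgroup (Op d n)ˣ}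
    (hG : IsStabilizerGroup G) : (G : Set (Op d n)ˣ).Finite := by
  choose! c v hcv using hG.multiple_weyl
  refine Set.Finite.of_injOn (f := v) (t := Set.univ) (fun _ _ => Set.mem_univ _) ?_
    Set.finite_univ
  intro g hg h hh hgh
  have hc : c g ≠ 0 := by
    intro h0
    have h1 := hcv g hg
    rw [h0, zero_smul] at h1
    exact g.ne_zero h1
  have key : (h : Op d n) = (c h / c g) • (g : Op d n) := by
    rw [hcv h hh, hcv g hg, smul_smul, div_mul_cancel₀ _ hc]
    rw [hgh]
  have h2 : h * g⁻¹ = 1 := by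
    refine hG.eq_one _ (G.mul_mem hh (G.inv_mem hg)) (c h / c g) ?_
    rw [Units.val_mul, key, smul_mul_assoc, Units.mul_inv]
  exact (mul_inv_eq_one.mp h2).symm

/-- The stabilizer state `ρ_G = d^{-n} ∑_{g ∈ G} g` of a stabilizer group `G`. -/
noncomputable def IsStabilizerGroup.state {d n : ℕ} [NeZero d] {G : Subgroup (Op d n)ˣ}
    (hG : IsStabilizerGroup G) : Op d n :=
  ((d : ℂ) ^ n)⁻¹ • ∑ g ∈ hG.finite.toFinset, (g : Op d n)

/-- `ρ` is a stabilizer state (pure or mixed) of `n` systems of local dimension `d`. -/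
def IsStabilizerState {d n : ℕ} [NeZero d] (ρ : Op d n) : Prop :=
  ∃ (G : Subgroup (Op d n)ˣ) (hG : IsStabilizerGroup G), ρ = hG.state

/-- The configuration of all `n` systems given by `a` on the systems in `I` and by `z` on
the others. -/
def glue {d n : ℕ} (I : Finset (Fin n)) (a : {i // i ∈ I} → ZMod d)
    (z : {i // i ∉ I} → ZMod d) : Fin n → ZMod d :=
  fun i => if h : i ∈ I then a ⟨i, h⟩ else z ⟨i, h⟩

/-- The reduced state `ρ_I = tr_{Iᶜ} ρ`. -/
noncomputable def reduced {d n : ℕ} [NeZero d] (ρ : Op d n) (I : Finset (Fin n)) :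
    Matrix ({i // i ∈ I} → ZMod d) ({i // i ∈ I} → ZMod d) ℂ :=
  Matrix.of fun a b => ∑ z : {i // i ∉ I} → ZMod d, ρ (glue I a z) (glue I b z)

/-- The von Neumann entropy `S(ρ) = -tr (ρ log ρ)`, by functional calculus with the
function `x ↦ -x log x` (natural logarithm, `0 log 0 = 0`). -/
noncomputable def vonNeumannEntropy {m : Type} [Fintype m] [DecidableEq m]
    (ρ : Matrix m m ℂ) : ℝ :=
  (Matrix.trace (cfc Real.negMulLog ρ)).re

/-- The entropy vector `s(ρ) = (S(ρ_I))_{I ⊆ [n]}`. -/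
noncomputable def entropyVector {d n : ℕ} [NeZero d] (ρ : Op d n) : Finset (Fin n) → ℝ :=
  fun I => vonNeumannEntropy (reduced ρ I)

/-- The rank vector `r(U) = (dim U_I)_{I ⊆ [n]}`, `U_I = span (⋃_{i ∈ I} U_i)`. -/
noncomputable def rankVector {F V : Type} [Field F] [AddCommGroup V] [Module F V] {n : ℕ}
    (U : Fin n → Submodule F V) : Finset (Fin n) → ℝ :=
  fun I => (Module.finrank F (Submodule.span F (⋃ i ∈ I, (U i : Set V))) : ℝ)

/-- The functional with coefficients `f` is a linear rank inequality: it is nonnegative on the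
rank vectors of all collections of subspaces of finite-dimensional vector spaces over
finite fields. -/
def IsLinearRankInequality {n : ℕ} (f : Finset (Fin n) → ℝ) : Prop :=
  ∀ (F V : Type) [Field F] [Finite F] [AddCommGroup V] [Module F V] [FiniteDimensional F V]
    (U : Fin n → Submodule F V), 0 ≤ ∑ I, f I * rankVector U I

/-- The functional with coefficients `f` is balanced: `∑_{I ∋ i} f_I = 0` for every `i`. -/
def IsBalanced {n : ℕ} (f : Finset (Fin n) → ℝ) : Prop :=
  ∀ i : Fin n, ∑ I with i ∈ I, f I = 0

end Stab

/-!
Let `M` be the set of phase-space vectors `v` such that some multiple of `w(v)` lies in the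
stabilizer group `G`. It is an additive subgroup, hence a subspace because `d` is prime, and
`G → M` is a bijection because the only multiple of the identity in `G` is the identity itself.
Write `M_I` for the vectors of `M` that vanish outside `I`.

A Weyl operator `w(v)` has nonzero trace only for `v = 0`, so the partial trace kills every
element of `G` whose label is not supported on `I`. The others form a subgroup on which the
partial trace is multiplicative up to a scalar. Hence `ρ_I` is Hermitian, has trace one and
satisfies `ρ_I² = (|M_I| / d^|I|) ρ_I`, which forces `S(ρ_I) = (|I| - dim M_I) log d`
(`IsStabilizerGroup.entropyVector_state`).

Now let `U_i` be the image of the phase space `ℤ_d²` of the `i`-th system in `ℤ_d^{2n} ⧸ M`. The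
span of the `U_i` with `i ∈ I` is the image of a space of dimension `2|I|` meeting `M` in `M_I`, so
its dimension is `2|I| - dim M_I` (`rankVector_systemSubspace`). Thus
`S(ρ_I) = (dim U_I - |I|) log d`, and a balanced functional vanishes on `I ↦ |I|`
(`IsBalanced.sum_mul_card`), so that its value on the entropy vector is `log d` times its value on
the rank vector of `U`.
-/

open scoped Matrix

namespace Stab

/-! ### Tensor products of matrices and their partial traces -/

/-- The tensor product `⨂ i, A i`, as a matrix indexed by the product of the index sets. -/
def tensor {ι α : Type*} [Fintype ι] (A : ι → Matrix α α ℂ) : Matrix (ι → α) (ι → α) ℂ :=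
  Matrix.of fun x y => ∏ i, A i (x i) (y i)

section Tensor

variable {ι α : Type*} [Fintype ι]

theorem conjTranspose_tensor (A : ι → Matrix α α ℂ) : (tensor A)ᴴ = tensor fun i => (A i)ᴴ := by
  ext x y
  simp [tensor, Matrix.conjTranspose_apply]

theorem tensor_smul (c : ι → ℂ) (A : ι → Matrix α α ℂ) :
    (tensor fun i => c i • A i) = (∏ i, c i) • tensor A := by
  ext x y
  simp [tensor, Finset.prod_mul_distrib]

theorem tensor_one [DecidableEq α] :
    (tensor fun _ : ι => (1 : Matrix α α ℂ)) = 1 := by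
  ext x y
  simp only [tensor, Matrix.of_apply, Matrix.one_apply, Finset.prod_ite_zero, funext_iff]
  simp

variable [DecidableEq ι] [Fintype α]

theorem tensor_mul (A B : ι → Matrix α α ℂ) :
    tensor A * tensor B = tensor fun i => A i * B i := by
  ext x y
  simp only [tensor, Matrix.mul_apply, Matrix.of_apply, ← Finset.prod_mul_distrib]
  rw [Finset.prod_univ_sum, Fintype.piFinset_univ]

theorem trace_tensor (A : ι → Matrix α α ℂ) : (tensor A).trace = ∏ i, (A i).trace := by
  simp only [tensor, Matrix.trace, Matrix.diag, Matrix.of_apply]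
  rw [Finset.prod_univ_sum, Fintype.piFinset_univ]

end Tensor

section Reduced

variable {d n : ℕ} [NeZero d]

theorem reduced_smul (c : ℂ) (ρ : Op d n) (I : Finset (Fin n)) :
    reduced (c • ρ) I = c • reduced ρ I := by
  ext a b
  simp [reduced, Finset.mul_sum]

theorem reduced_sum {κ : Type*} (s : Finset κ) (ρ : κ → Op d n) (I : Finset (Fin n)) :
    reduced (∑ k ∈ s, ρ k) I = ∑ k ∈ s, reduced (ρ k) I := by
  ext a b
  simp only [reduced, Matrix.of_apply, Matrix.sum_apply]
  exact Finset.sum_comm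

theorem reduced_isHermitian {ρ : Op d n} (hρ : ρ.IsHermitian) (I : Finset (Fin n)) :
    (reduced ρ I).IsHermitian := by
  ext a b
  simp only [reduced, Matrix.conjTranspose_apply, Matrix.of_apply, star_sum]
  exact Finset.sum_congr rfl fun z _ => hρ.apply _ _

theorem trace_reduced (ρ : Op d n) (I : Finset (Fin n)) : (reduced ρ I).trace = ρ.trace := by
  simp only [reduced, Matrix.trace, Matrix.diag, Matrix.of_apply]
  rw [← Fintype.sum_prod_type']
  exact Fintype.sum_equiv (Equiv.piEquivPiSubtypeProd (· ∈ I) fun _ => ZMod d).symm _ _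
    fun _ => rfl

theorem reduced_tensor (A : Fin n → Matrix (ZMod d) (ZMod d) ℂ) (I : Finset (Fin n)) :
    reduced (tensor A) I =
      (∏ i : {i // i ∉ I}, (A i).trace) • tensor fun i : {i // i ∈ I} => A i := by
  ext a b
  have hsplit (z : {i // i ∉ I} → ZMod d) :
      ∏ i, A i (glue I a z i) (glue I b z i) =
        (∏ i : {i // i ∈ I}, A i (a i) (b i)) * ∏ i : {i // i ∉ I}, A i (z i) (z i) := by
    rw [← Fintype.prod_subtype_mul_prod_subtype (· ∈ I)]
    congr 1
    · refine Finset.prod_congr ?_ fun i _ => by simp [glue]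
      ext
      simp
    · exact Finset.prod_congr rfl fun i _ => by simp [glue, i.2]
  simp only [reduced, tensor, Matrix.of_apply, hsplit, ← Finset.mul_sum, Matrix.smul_apply,
    smul_eq_mul, Matrix.trace, Matrix.diag]
  rw [Finset.prod_univ_sum, Fintype.piFinset_univ, mul_comm]

end Reduced

/-! ### The algebra of Weyl operators -/

section Weyl

variable {d n : ℕ}

theorem norm_chi (m : ℕ) (x : ℤ) : ‖chi m x‖ = 1 := by
  have : chi m x = Complex.exp ((2 * Real.pi * x / m : ℝ) * Complex.I) := by
    unfold chi
    congr 1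
    push_cast
    ring
  rw [this, Complex.norm_exp_ofReal_mul_I]

/-- The scalar prefactor `τ_{2d}(-PQ)` of the one-system Weyl operator. -/
noncomputable def weylPhase (u : ZMod d × ZMod d) : ℂ :=
  tau d (-((u.1.val : ℤ) * (u.2.val : ℤ)))

theorem norm_weylPhase (u : ZMod d × ZMod d) : ‖weylPhase u‖ = 1 := norm_chi _ _

theorem weylPhase_ne_zero (u : ZMod d × ZMod d) : weylPhase u ≠ 0 :=
  norm_ne_zero_iff.mp (by simp [norm_weylPhase])

theorem weyl_eq_tensor (v : PhaseSpace d n) : weyl v = tensor fun i => weylOne d (v i) := rfl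

variable [NeZero d]

theorem chi_eq_stdAddChar (x : ℤ) : chi d x = ZMod.stdAddChar (x : ZMod d) := by
  rw [ZMod.stdAddChar_coe, chi]

theorem weylOne_apply (u : ZMod d × ZMod d) (x y : ZMod d) :
    weylOne d u x y = if y = x - u.2 then weylPhase u * ZMod.stdAddChar (u.1 * x) else 0 := by
  simp [weylOne, weylInt, weylPhase, chi_eq_stdAddChar]

theorem weylOne_zero : weylOne d 0 = 1 := by
  ext x y
  have : weylPhase (0 : ZMod d × ZMod d) = 1 := by simp [weylPhase, tau, chi]
  simp [weylOne_apply, this, Matrix.one_apply, eq_comm]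

/-- Weyl operators form a projective representation of the phase space. -/
theorem weylOne_mul (u v : ZMod d × ZMod d) :
    ∃ κ : ℂ, κ ≠ 0 ∧ weylOne d u * weylOne d v = κ • weylOne d (u + v) := by
  refine ⟨weylPhase u * weylPhase v * ZMod.stdAddChar (-(v.1 * u.2)) / weylPhase (u + v),
    ?_, ?_⟩
  · exact div_ne_zero (mul_ne_zero (mul_ne_zero (weylPhase_ne_zero _) (weylPhase_ne_zero _))
      (norm_ne_zero_iff.mp (by simp))) (weylPhase_ne_zero _)
  · ext x z
    rw [Matrix.mul_apply, Finset.sum_eq_single (x - u.2)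
      (fun y _ hy => by simp [weylOne_apply u, hy]) (by simp)]
    simp only [weylOne_apply, if_true, Matrix.smul_apply, smul_eq_mul, mul_ite, mul_zero,
      Prod.fst_add, Prod.snd_add, sub_sub]
    split_ifs
    · have h : (u.1 + v.1) * x = u.1 * x + v.1 * x := by ring
      have h' : v.1 * (x - u.2) = v.1 * x + -(v.1 * u.2) := by ring
      rw [h, h', AddChar.map_add_eq_mul, AddChar.map_add_eq_mul]
      field_simp [weylPhase_ne_zero (u + v)]
    · rfl

theorem trace_weylOne (u : ZMod d × ZMod d) :
    (weylOne d u).trace = if u = 0 then (d : ℂ) else 0 := by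
  split_ifs with hu
  · subst hu
    rw [weylOne_zero, Matrix.trace_one, ZMod.card]
  · simp only [Matrix.trace, Matrix.diag, weylOne_apply]
    by_cases h2 : u.2 = 0
    · have h1 : u.1 ≠ 0 := fun h1 => hu (Prod.ext h1 h2)
      have := AddChar.sum_mulShift u.1 (ZMod.isPrimitive_stdAddChar d)
      simp only [h1, if_false] at this
      simp [h2, ← Finset.mul_sum, mul_comm u.1, this]
    · exact Finset.sum_eq_zero fun x _ => if_neg (by simpa [eq_comm (a := x)] using h2)

theorem conjTranspose_weylOne_mul_self (u : ZMod d × ZMod d) :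
    (weylOne d u)ᴴ * weylOne d u = 1 := by
  ext x z
  have hn : ‖weylPhase u * ZMod.stdAddChar (u.1 * (x + u.2))‖ = 1 := by
    simp [norm_weylPhase]
  rw [Matrix.mul_apply, Finset.sum_eq_single (x + u.2) _ (by simp)]
  · simp only [Matrix.conjTranspose_apply, weylOne_apply, add_sub_cancel_right, if_true,
      Matrix.one_apply, mul_ite, mul_zero, eq_comm (a := z), Complex.star_def,
      Complex.conj_mul', hn]
    norm_num
  · intro y _ hy
    have : x ≠ y - u.2 := fun h => hy (by rw [h, sub_add_cancel])
    simp [weylOne_apply, this]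

theorem weyl_zero : weyl (0 : PhaseSpace d n) = 1 := by
  simp [weyl_eq_tensor, weylOne_zero, tensor_one]

theorem weyl_mul (u v : PhaseSpace d n) :
    ∃ κ : ℂ, κ ≠ 0 ∧ weyl u * weyl v = κ • weyl (u + v) := by
  choose κ hκ h using fun i => weylOne_mul (u i) (v i)
  refine ⟨∏ i, κ i, Finset.prod_ne_zero_iff.mpr fun i _ => hκ i, ?_⟩
  simp only [weyl_eq_tensor, tensor_mul, h, tensor_smul, Pi.add_apply]

theorem trace_weyl_of_ne_zero {v : PhaseSpace d n} (hv : v ≠ 0) : (weyl v).trace = 0 := by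
  obtain ⟨i, hi⟩ := Function.ne_iff.mp hv
  rw [weyl_eq_tensor, trace_tensor]
  exact Finset.prod_eq_zero (Finset.mem_univ i) (by rw [trace_weylOne]; exact if_neg hi)

theorem conjTranspose_weyl_mul_self (v : PhaseSpace d n) : (weyl v)ᴴ * weyl v = 1 := by
  simp only [weyl_eq_tensor, conjTranspose_tensor, tensor_mul, conjTranspose_weylOne_mul_self,
    tensor_one]

/-- Different Weyl operators are not proportional, since only `w(0)` has nonzero trace. -/
theorem eq_of_smul_weyl_eq {u v : PhaseSpace d n} {a b : ℂ} (ha : a ≠ 0)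
    (h : a • weyl u = b • weyl v) : u = v := by
  by_contra huv
  obtain ⟨κ, -, h₁⟩ := weyl_mul u (-v)
  obtain ⟨μ, hμ, h₂⟩ := weyl_mul v (-v)
  obtain ⟨ν, hν, h₃⟩ := weyl_mul u (-u)
  have hb : b ≠ 0 := by
    rintro rfl
    have h0 : weyl u = 0 := by simpa [ha] using h
    have := h₃
    rw [h0, zero_mul, add_neg_cancel, weyl_zero] at this
    exact smul_ne_zero hν one_ne_zero this.symm
  have key := congrArg (fun A => (A * weyl (-v)).trace) h
  simp only [smul_mul_assoc, h₁, h₂, ← sub_eq_add_neg, sub_self, weyl_zero, Matrix.trace_smul,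
    trace_weyl_of_ne_zero (sub_ne_zero.mpr huv), Matrix.trace_one, smul_eq_mul, mul_zero] at key
  exact mul_ne_zero hb (mul_ne_zero hμ (by simp [NeZero.ne d])) key.symm

theorem reduced_weyl_of_ne_zero {v : PhaseSpace d n} {I : Finset (Fin n)} {i : Fin n}
    (hi : i ∉ I) (hv : v i ≠ 0) : reduced (weyl v) I = 0 := by
  rw [weyl_eq_tensor, reduced_tensor,
    Finset.prod_eq_zero (Finset.mem_univ (⟨i, hi⟩ : {i // i ∉ I})), zero_smul]
  rw [trace_weylOne, if_neg hv]

/-- On operators acting as the identity outside `I`, the partial trace is multiplicative up to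
the dimension of the discarded factor. -/
theorem reduced_weyl_mul {u v : PhaseSpace d n} {I : Finset (Fin n)}
    (hu : ∀ i ∉ I, u i = 0) (hv : ∀ i ∉ I, v i = 0) :
    reduced (weyl u) I * reduced (weyl v) I =
      ((d : ℂ) ^ (n - I.card)) • reduced (weyl u * weyl v) I := by
  have hcard : Fintype.card {i // i ∉ I} = n - I.card := by
    simp [Fintype.card_subtype_compl]
  have hprod (A : Fin n → Matrix (ZMod d) (ZMod d) ℂ) (hA : ∀ i ∉ I, A i = 1) :
      ∏ i : {i // i ∉ I}, (A i).trace = (d : ℂ) ^ (n - I.card) := by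
    rw [Finset.prod_congr rfl fun i _ => by rw [hA i i.2]]
    simp [hcard, Matrix.trace_one]
  have h1 (w : PhaseSpace d n) (hw : ∀ i ∉ I, w i = 0) (i) (hi : i ∉ I) :
      weylOne d (w i) = 1 := by rw [hw i hi, weylOne_zero]
  rw [weyl_eq_tensor, weyl_eq_tensor, tensor_mul, reduced_tensor, reduced_tensor, reduced_tensor,
    hprod _ (h1 u hu), hprod _ (h1 v hv),
    hprod (fun i => weylOne d (u i) * weylOne d (v i))
      fun i hi => by rw [h1 u hu i hi, h1 v hv i hi, one_mul],
    smul_mul_smul_comm, tensor_mul, smul_smul]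

end Weyl

/-! ### Entropy of normalized projections -/

/-- A density matrix with `ρ² = r ρ` has spectrum inside `{0, r}`, where `-x log x` agrees with the
linear function `x ↦ -(log r) x`; so no diagonalization is needed. -/
theorem vonNeumannEntropy_eq_neg_log {m : Type} [Fintype m] [DecidableEq m] {ρ : Matrix m m ℂ}
    (hρ : ρ.IsHermitian) {r : ℝ} (hsq : ρ * ρ = (r : ℂ) • ρ) (htr : ρ.trace = 1) :
    vonNeumannEntropy ρ = -Real.log r := by
  have hspec : (spectrum ℝ ρ).EqOn Real.negMulLog fun x => -Real.log r * x := by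
    intro x hx
    have hne : Nontrivial (Matrix m m ℂ) := by
      refine ⟨ρ, 0, ?_⟩
      rintro rfl
      simp at htr
    -- `ρ` is annihilated by `p`, so every point of its spectrum is a root of `p`.
    let p : Polynomial ℝ := Polynomial.X ^ 2 - Polynomial.C r * Polynomial.X
    have hp : Polynomial.aeval ρ p = 0 := by
      have : r • ρ = (r : ℂ) • ρ := by
        ext i j
        simp
      rw [map_sub, map_mul, map_pow, Polynomial.aeval_X, Polynomial.aeval_C, pow_two, hsq,
        ← Algebra.smul_def, this, sub_self]
    have hmem := spectrum.subset_polynomial_aeval ρ p ⟨x, hx, rfl⟩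
    rw [hp, spectrum.zero_eq, Set.mem_singleton_iff] at hmem
    have h0 : x * (x - r) = 0 := by
      simp only [p, Polynomial.eval_sub, Polynomial.eval_pow, Polynomial.eval_X,
        Polynomial.eval_mul, Polynomial.eval_C] at hmem
      linear_combination hmem
    rcases mul_eq_zero.mp h0 with rfl | h0
    · simp
    · obtain rfl := sub_eq_zero.mp h0
      simp only [Real.negMulLog]
      ring
  rw [vonNeumannEntropy, cfc_congr hspec, cfc_const_mul_id _ ρ hρ.isSelfAdjoint,
    Matrix.trace_smul, htr]
  simp

/-! ### Stabilizer groups -/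

section Stabilizer

variable {d n : ℕ}

/-- The phase-space vectors supported on the systems in `I`. -/
def supported (d : ℕ) {n : ℕ} (I : Finset (Fin n)) : Submodule (ZMod d) (PhaseSpace d n) :=
  ⨅ i ∈ {i | i ∉ I}, LinearMap.ker (LinearMap.proj i)

theorem mem_supported {I : Finset (Fin n)} {v : PhaseSpace d n} :
    v ∈ supported d I ↔ ∀ i ∉ I, v i = 0 := by
  simp [supported]

variable [NeZero d]

theorem ne_zero_of_eq_smul_weyl {g : (Op d n)ˣ} {c : ℂ} {v : PhaseSpace d n}
    (h : (g : Op d n) = c • weyl v) : c ≠ 0 := by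
  rintro rfl
  have : Nonempty (Fin n → ZMod d) := ⟨0⟩
  exact g.ne_zero (by rw [h, zero_smul])

theorem inv_eq_smul_weyl {g : (Op d n)ˣ} {c : ℂ} {v : PhaseSpace d n}
    (h : (g : Op d n) = c • weyl v) : ∃ c' : ℂ, ((g⁻¹ : (Op d n)ˣ) : Op d n) = c' • weyl (-v) := by
  obtain ⟨κ, hκ, hmul⟩ := weyl_mul v (-v)
  rw [add_neg_cancel, weyl_zero] at hmul
  have hc := ne_zero_of_eq_smul_weyl h
  refine ⟨(c * κ)⁻¹, Units.inv_eq_of_mul_eq_one_right ?_⟩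
  have hone : c * (c * κ)⁻¹ * κ = 1 := by field_simp
  rw [h, smul_mul_smul_comm, hmul, smul_smul, hone, one_smul]

theorem mul_eq_smul_weyl {g h : (Op d n)ˣ} {a b : ℂ} {u v : PhaseSpace d n}
    (hg : (g : Op d n) = a • weyl u) (hh : (h : Op d n) = b • weyl v) :
    ∃ c : ℂ, ((g * h : (Op d n)ˣ) : Op d n) = c • weyl (u + v) := by
  obtain ⟨κ, -, hmul⟩ := weyl_mul u v
  exact ⟨a * b * κ, by rw [Units.val_mul, hg, hh, smul_mul_smul_comm, hmul, smul_smul]⟩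

/-- The labels `v` of the Weyl operators occurring, up to a scalar, in `G`. -/
def labels (G : Subgroup (Op d n)ˣ) : AddSubgroup (PhaseSpace d n) where
  carrier := {v | ∃ g ∈ G, ∃ c : ℂ, (g : Op d n) = c • weyl v}
  zero_mem' := ⟨1, G.one_mem, 1, by rw [weyl_zero, one_smul, Units.val_one]⟩
  add_mem' := by
    rintro u v ⟨g, hg, a, ha⟩ ⟨h, hh, b, hb⟩
    exact ⟨g * h, G.mul_mem hg hh, mul_eq_smul_weyl ha hb⟩
  neg_mem' := by
    rintro v ⟨g, hg, a, ha⟩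
    exact ⟨g⁻¹, G.inv_mem hg, inv_eq_smul_weyl ha⟩

/-- The multiples of Weyl operators that act as a scalar on every system outside `I`. -/
def weylSupported (I : Finset (Fin n)) : Subgroup (Op d n)ˣ where
  carrier := {g | ∃ (c : ℂ) (v : PhaseSpace d n), (g : Op d n) = c • weyl v ∧ ∀ i ∉ I, v i = 0}
  one_mem' := ⟨1, 0, by rw [weyl_zero, one_smul, Units.val_one], fun _ _ => rfl⟩
  mul_mem' := by
    rintro g h ⟨a, u, hg, hu⟩ ⟨b, v, hh, hv⟩
    obtain ⟨c, hc⟩ := mul_eq_smul_weyl hg hh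
    exact ⟨c, u + v, hc, fun i hi => by simp [hu i hi, hv i hi]⟩
  inv_mem' := by
    rintro g ⟨a, u, hg, hu⟩
    obtain ⟨c, hc⟩ := inv_eq_smul_weyl hg
    exact ⟨c, -u, hc, fun i hi => by simp [hu i hi]⟩

theorem labels_inf_weylSupported (G : Subgroup (Op d n)ˣ)
    (I : Finset (Fin n)) :
    AddSubgroup.toZModSubmodule d (labels (G ⊓ weylSupported I)) =
      supported d I ⊓ AddSubgroup.toZModSubmodule d (labels G) := by
  ext v
  simp only [AddSubgroup.mem_toZModSubmodule, Submodule.mem_inf, mem_supported]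
  constructor
  · rintro ⟨g, ⟨hg, a, u, hgu, hu⟩, b, hgv⟩
    obtain rfl := eq_of_smul_weyl_eq (ne_zero_of_eq_smul_weyl hgu) (hgu.symm.trans hgv)
    exact ⟨hu, g, hg, a, hgu⟩
  · rintro ⟨hv, g, hg, a, hgv⟩
    exact ⟨g, ⟨hg, a, v, hgv, hv⟩, a, hgv⟩

namespace IsStabilizerGroup

variable {G : Subgroup (Op d n)ˣ}

theorem mono (hG : IsStabilizerGroup G) {H : Subgroup (Op d n)ˣ} (hHG : H ≤ G) :
    IsStabilizerGroup H :=
  ⟨fun g hg => hG.multiple_weyl g (hHG hg), fun g hg => hG.eq_one g (hHG hg)⟩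

/-- An element of a stabilizer group is determined by its label. -/
theorem eq_of_smul_weyl (hG : IsStabilizerGroup G) {g h : (Op d n)ˣ} (hg : g ∈ G) (hh : h ∈ G)
    {a b : ℂ} {v : PhaseSpace d n} (ha : (g : Op d n) = a • weyl v)
    (hb : (h : Op d n) = b • weyl v) : g = h := by
  have hb0 := ne_zero_of_eq_smul_weyl hb
  refine mul_inv_eq_one.mp (hG.eq_one _ (G.mul_mem hg (G.inv_mem hh)) (a / b) ?_)
  have key : (g : Op d n) = (a / b) • (h : Op d n) := by
    rw [ha, hb, smul_smul, div_mul_cancel₀ _ hb0]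
  rw [Units.val_mul, key, smul_mul_assoc, Units.mul_inv]

theorem card_eq_card_labels (hG : IsStabilizerGroup G) :
    hG.finite.toFinset.card = Nat.card (labels G) := by
  choose! c v hcv using hG.multiple_weyl
  have hbij : Set.BijOn v (G : Set (Op d n)ˣ) (labels G) := by
    refine ⟨fun g hg => ⟨g, hg, _, hcv g hg⟩, fun g hg h hh hgh => ?_, ?_⟩
    · exact hG.eq_of_smul_weyl hg hh (hcv g hg) (hgh ▸ hcv h hh)
    · rintro u ⟨g, hg, a, ha⟩
      refine ⟨g, hg, (eq_of_smul_weyl_eq (ne_zero_of_eq_smul_weyl ha)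
        (ha.symm.trans (hcv g hg))).symm⟩
  rw [← Set.ncard_eq_toFinset_card _ hG.finite]
  exact Nat.card_congr (hbij.equiv v)

/-- Elements of a stabilizer group are unitary: they are multiples of unitaries, and of finite
order. -/
theorem conjTranspose_eq_inv (hG : IsStabilizerGroup G) {g : (Op d n)ˣ} (hg : g ∈ G) :
    (g : Op d n)ᴴ = ((g⁻¹ : (Op d n)ˣ) : Op d n) := by
  obtain ⟨c, v, hcv⟩ := hG.multiple_weyl g hg
  have : Finite G := hG.finite
  obtain ⟨k, hk, hgk⟩ := (isOfFinOrder_of_finite (⟨g, hg⟩ : G)).exists_pow_eq_one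
  replace hgk : g ^ k = 1 := congrArg Subtype.val hgk
  have hstar : (g : Op d n)ᴴ * g = ((‖c‖ ^ 2 : ℝ) : ℂ) • 1 := by
    rw [hcv, Matrix.conjTranspose_smul, smul_mul_smul_comm, conjTranspose_weyl_mul_self,
      Complex.star_def, Complex.conj_mul']
    push_cast
    rfl
  have hconj : (g : Op d n)ᴴ = ((‖c‖ ^ 2 : ℝ) : ℂ) • ((g⁻¹ : (Op d n)ˣ) : Op d n) := by
    rw [← Units.mul_inv_cancel_right ((g : Op d n)ᴴ) g, hstar, smul_mul_assoc, one_mul]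
  have hpow := congrArg (· ^ k) hconj
  simp only [← Matrix.conjTranspose_pow, smul_pow, ← Units.val_pow_eq_pow_val, inv_pow, hgk,
    inv_one, Units.val_one, Matrix.conjTranspose_one] at hpow
  -- Since `g ^ k = 1`, the `k`-th power of `gᴴ = ‖c‖² g⁻¹` says that `‖c‖² = 1`.
  have h1 : (((‖c‖ ^ 2) ^ k : ℝ) : ℂ) = 1 := by
    have := congrFun (congrFun hpow 0) 0
    simp only [Matrix.smul_apply, Matrix.one_apply_eq, smul_eq_mul, mul_one] at this
    exact_mod_cast this.symm
  have h2 : ‖c‖ ^ 2 = 1 :=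
    (pow_eq_one_iff_of_nonneg (by positivity) hk.ne').mp (by exact_mod_cast h1)
  rw [hconj, h2, Complex.ofReal_one, one_smul]

theorem state_isHermitian (hG : IsStabilizerGroup G) : hG.state.IsHermitian := by
  rw [Matrix.IsHermitian, state, Matrix.conjTranspose_smul, Matrix.conjTranspose_sum]
  congr 1
  · simp
  · refine Finset.sum_nbij' (·⁻¹) (·⁻¹) ?_ ?_ ?_ ?_ ?_
    · simp
    · simp
    · simp
    · simp
    · intro g hg
      exact hG.conjTranspose_eq_inv (by simpa using hg)

theorem trace_state (hG : IsStabilizerGroup G) : hG.state.trace = 1 := by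
  rw [state, Matrix.trace_smul, Matrix.trace_sum, Finset.sum_eq_single 1]
  · simp [Matrix.trace_one, NeZero.ne d]
  · intro g hg hg1
    rw [Set.Finite.mem_toFinset] at hg
    obtain ⟨c, v, hcv⟩ := hG.multiple_weyl g hg
    have hv : v ≠ 0 := by
      rintro rfl
      exact hg1 (hG.eq_one g hg c (by rw [hcv, weyl_zero]))
    rw [hcv, Matrix.trace_smul, trace_weyl_of_ne_zero hv, smul_zero]
  · intro h
    exact absurd (by simp) h

/-- Only the elements supported on `I` contribute to the reduced state. -/
theorem reduced_state (hG : IsStabilizerGroup G) (I : Finset (Fin n)) :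
    reduced hG.state I = ((d : ℂ) ^ n)⁻¹ •
      ∑ g ∈ (hG.mono (inf_le_left : G ⊓ weylSupported I ≤ G)).finite.toFinset,
        reduced (g : Op d n) I := by
  rw [state, reduced_smul, reduced_sum]
  congr 1
  symm
  refine Finset.sum_subset (fun g hg => ?_) fun g hg hgI => ?_
  · simp only [Set.Finite.mem_toFinset, SetLike.mem_coe, Subgroup.mem_inf] at hg ⊢
    exact hg.1
  · simp only [Set.Finite.mem_toFinset, SetLike.mem_coe, Subgroup.mem_inf] at hg hgI
    obtain ⟨c, v, hcv⟩ := hG.multiple_weyl g hg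
    have : ∃ i ∉ I, v i ≠ 0 := by
      by_contra! h
      exact hgI ⟨hg, c, v, hcv, h⟩
    obtain ⟨i, hi, hvi⟩ := this
    rw [hcv, reduced_smul, reduced_weyl_of_ne_zero hi hvi, smul_zero]

/-- The reduced states are multiples of projections. -/
theorem reduced_state_mul_self (hG : IsStabilizerGroup G) (I : Finset (Fin n)) :
    reduced hG.state I * reduced hG.state I =
      ((Nat.card (labels (G ⊓ weylSupported I)) : ℂ) / (d : ℂ) ^ I.card) •
        reduced hG.state I := by
  have hGI := hG.mono (inf_le_left : G ⊓ weylSupported I ≤ G)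
  have hd : (d : ℂ) ≠ 0 := by exact_mod_cast NeZero.ne d
  have hI : I.card ≤ n := by simpa using I.card_le_univ
  rw [← hGI.card_eq_card_labels, hG.reduced_state]
  set T := hGI.finite.toFinset with hT
  have hmem {g : (Op d n)ˣ} : g ∈ T ↔ g ∈ G ⊓ weylSupported I := by simp [hT]
  have hrow (g : (Op d n)ˣ) (hg : g ∈ T) :
      reduced (g : Op d n) I * ∑ h ∈ T, reduced (h : Op d n) I =
        (d : ℂ) ^ (n - I.card) • ∑ h ∈ T, reduced (h : Op d n) I := by
    -- Multiplication by `g` permutes the elements supported on `I`.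
    have hshift : ∑ h ∈ T, reduced ((g * h : (Op d n)ˣ) : Op d n) I =
        ∑ h ∈ T, reduced (h : Op d n) I := by
      refine Finset.sum_nbij' (g * ·) (g⁻¹ * ·) ?_ ?_ ?_ ?_ ?_
      · exact fun h hh => hmem.mpr (mul_mem (hmem.mp hg) (hmem.mp hh))
      · exact fun h hh => hmem.mpr (mul_mem (inv_mem (hmem.mp hg)) (hmem.mp hh))
      · simp
      · simp
      · simp
    rw [Finset.mul_sum, ← hshift, Finset.smul_sum]
    refine Finset.sum_congr rfl fun h hh => ?_
    obtain ⟨-, a, u, hgu, hu⟩ := hmem.mp hg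
    obtain ⟨-, b, v, hhv, hv⟩ := hmem.mp hh
    rw [Units.val_mul, hgu, hhv, reduced_smul, reduced_smul, smul_mul_smul_comm,
      smul_mul_smul_comm, reduced_smul, reduced_weyl_mul hu hv, smul_comm]
  rw [smul_mul_smul_comm, Finset.sum_mul, Finset.sum_congr rfl hrow, Finset.sum_const,
    ← Nat.cast_smul_eq_nsmul ℂ, smul_smul, smul_smul, smul_smul]
  congr 1
  have hn : (d : ℂ) ^ n = (d : ℂ) ^ (n - I.card) * (d : ℂ) ^ I.card := by
    rw [← pow_add, Nat.sub_add_cancel hI]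
  rw [hn]
  field_simp

/-- With `M` the space of labels of `G`, the entropy of the reduced state on `I` is
`(|I| - dim M_I) log d`, where `M_I` consists of the vectors in `M` supported on `I`. -/
theorem entropyVector_state [Fact d.Prime] (hG : IsStabilizerGroup G) (I : Finset (Fin n)) :
    entropyVector hG.state I =
      (I.card - Module.finrank (ZMod d)
        ↥(supported d I ⊓ AddSubgroup.toZModSubmodule d (labels G)) : ℝ) * Real.log d := by
  have hd : (d : ℝ) ≠ 0 := by exact_mod_cast NeZero.ne d
  have hcard : Nat.card (labels (G ⊓ weylSupported I)) = d ^ Module.finrank (ZMod d)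
      ↥(supported d I ⊓ AddSubgroup.toZModSubmodule d (labels G)) := by
    rw [← labels_inf_weylSupported]
    exact (Module.natCard_eq_pow_finrank (K := ZMod d)).trans (by rw [Nat.card_zmod]; rfl)
  have hsq := hG.reduced_state_mul_self I
  rw [hcard] at hsq
  rw [entropyVector, vonNeumannEntropy_eq_neg_log
    (r := (d : ℝ) ^ Module.finrank (ZMod d)
      ↥(supported d I ⊓ AddSubgroup.toZModSubmodule d (labels G)) / (d : ℝ) ^ I.card)
    (reduced_isHermitian hG.state_isHermitian I) (by rw [hsq]; push_cast; rfl)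
    (by rw [trace_reduced, hG.trace_state]),
    Real.log_div (by positivity) (by positivity), Real.log_pow, Real.log_pow]
  ring

end IsStabilizerGroup

end Stabilizer

/-! ### The subspace arrangement of a stabilizer group -/

section Rank

variable {d n : ℕ} [Fact d.Prime]

/-- The image, in the quotient of the phase space by `M`, of the phase space of the `i`-th
system. -/
def systemSubspace (M : Submodule (ZMod d) (PhaseSpace d n)) (i : Fin n) :
    Submodule (ZMod d) (PhaseSpace d n ⧸ M) :=
  (LinearMap.range (LinearMap.single (ZMod d) (fun _ : Fin n => ZMod d × ZMod d) i)).map M.mkQ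

theorem finrank_supported (I : Finset (Fin n)) :
    Module.finrank (ZMod d) (supported d I) = 2 * I.card := by
  have e := LinearMap.iInfKerProjEquiv (ZMod d) (fun _ : Fin n => ZMod d × ZMod d)
    (I := {i | i ∈ I}) (J := {i | i ∉ I})
    (Set.disjoint_left.mpr fun i hi hi' => hi' hi) (fun i _ => em _)
  rw [supported, e.finrank_eq, Module.finrank_pi_fintype]
  simp [mul_comm]

theorem span_systemSubspace (M : Submodule (ZMod d) (PhaseSpace d n)) (I : Finset (Fin n)) :
    Submodule.span (ZMod d) (⋃ i ∈ I, (systemSubspace M i : Set (PhaseSpace d n ⧸ M))) =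
      (supported d I).map M.mkQ := by
  have h := LinearMap.iSup_range_single_eq_iInf_ker_proj (ZMod d)
    (fun _ : Fin n => ZMod d × ZMod d) (I := {i | i ∈ I}) (J := {i | i ∉ I})
    isCompl_compl (Set.toFinite _)
  rw [supported, ← h]
  simp only [Submodule.span_iUnion, Submodule.span_eq, Submodule.map_iSup, systemSubspace,
    Set.mem_ofPred_eq]

theorem rankVector_systemSubspace (M : Submodule (ZMod d) (PhaseSpace d n))
    (I : Finset (Fin n)) :
    rankVector (systemSubspace M) I =
      2 * I.card - Module.finrank (ZMod d) ↥(supported d I ⊓ M) := by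
  have h := LinearMap.finrank_range_add_finrank_ker (M.mkQ.domRestrict (supported d I))
  have hker : Module.finrank (ZMod d) (LinearMap.ker (M.mkQ.domRestrict (supported d I))) =
      Module.finrank (ZMod d) ↥(supported d I ⊓ M) := by
    rw [LinearMap.ker_domRestrict, Submodule.ker_mkQ, ← Submodule.map_comap_subtype]
    exact (Submodule.equivSubtypeMap _ _).finrank_eq
  rw [LinearMap.range_domRestrict, hker, finrank_supported] at h
  rw [rankVector, span_systemSubspace, eq_sub_iff_add_eq]
  exact_mod_cast h

end Rank

theorem IsBalanced.sum_mul_card {n : ℕ} {f : Finset (Fin n) → ℝ} (hf : IsBalanced f) :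
    ∑ I, f I * I.card = 0 := by
  calc ∑ I, f I * I.card = ∑ I, ∑ i, if i ∈ I then f I else 0 := by
        refine Finset.sum_congr rfl fun I _ => ?_
        simp [mul_comm]
    _ = ∑ i, ∑ I with i ∈ I, f I := by
        rw [Finset.sum_comm]
        simp only [Finset.sum_filter]
    _ = 0 := Finset.sum_eq_zero fun i _ => hf i

end Stab

theorem mainTheorem9 (d n : ℕ) [NeZero d] (hd : d.Prime)
    (ρ : Stab.Op d n) (hρ : Stab.IsStabilizerState ρ)
    (f : Finset (Fin n) → ℝ) (hrank : Stab.IsLinearRankInequality f)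
    (hbal : Stab.IsBalanced f) :
    0 ≤ ∑ I, f I * Stab.entropyVector ρ I := by
  obtain ⟨G, hG, rfl⟩ := hρ
  have : Fact d.Prime := ⟨hd⟩
  let M := AddSubgroup.toZModSubmodule d (Stab.labels G)
  have hS (I : Finset (Fin n)) : Stab.entropyVector hG.state I =
      (Stab.rankVector (Stab.systemSubspace M) I - I.card) * Real.log d := by
    rw [hG.entropyVector_state, Stab.rankVector_systemSubspace]
    ring
  have hsum : ∑ I, f I * Stab.entropyVector hG.state I =
      (∑ I, f I * Stab.rankVector (Stab.systemSubspace M) I) * Real.log d := by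
    calc ∑ I, f I * Stab.entropyVector hG.state I
        = (∑ I, f I * Stab.rankVector (Stab.systemSubspace M) I - ∑ I, f I * I.card) *
            Real.log d := by
          rw [← Finset.sum_sub_distrib, Finset.sum_mul]
          refine Finset.sum_congr rfl fun I _ => ?_
          rw [hS]
          ring
      _ = _ := by rw [hbal.sum_mul_card, sub_zero]
  rw [hsum]
  exact mul_nonneg (hrank _ _ _) (Real.log_natCast_nonneg d)
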